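/- Let $n\ge 0$ be an even integer and let $C\subsetneq\mathbb F_2^n$ be a nonempty binary code of length $n$, not equal to the whole space, linear or not. For a binary code $D$ of length $m$ and $x\in\mathbb F_2^m$, let $d(x,D)$ be the Hamming distance from $x$ to $D$, let $\rho(D)=\max_{x} d(x,D)$ be the covering radius of $D$, and let $B_{x,i}(D)$ be the number of codewords of $D$ at Hamming distance $i$ from $x$. The code $D$ is called *completely regular* if, for all $x\in\mathbb F_2^m$ and $0\le i\le\rho(D)$, the number $B_{x,i}(D)$ depends only on $i$ and $d(x,D)$; it is called *uniformly packed in the wide sense* if there are rational numbers $\beta_0,\dots,\beta_{\rho(D)}$ such that $\sum_{i=0}^{\rho(D)}\beta_i B_{x,i}(D)=1$ for every $x\in\mathbb F_2^m$. Suppose that $C$ is completely regular and self-complementary, i.e. $c+(1,\dots,1)\in C$ for every $c\in C$. Let $C^*$ be the extended code of length $n+1$, obtained by appending to each codeword of $C$ its parity check bit, $C^*=\{(c_1,\dots,c_n,c_1+\cdots+c_n): c\in C\}$, or alternatively by appending to each codeword its antiparity check bit $c_1+\cdots+c_n+1$. Then $C^*$ is not uniformly packed in the wide sense, and $C^*$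 is not completely regular. -/

import Mathlib

namespace BinCode

/-- The distance `d(x, C)` from a word `x` to a nonempty binary code `C`. -/
noncomputable def distToCode {n : ℕ} (C : Finset (Fin n → ZMod 2)) (x : Fin n → ZMod 2) : ℕ :=
  sInf {k : ℕ | ∃ c ∈ C, hammingDist x c = k}

/-- The covering radius `ρ` of `C`: the largest distance from a word to `C`. -/
noncomputable def coveringRadius {n : ℕ} (C : Finset (Fin n → ZMod 2)) : ℕ :=
  Finset.univ.sup (distToCode C)

/-- The entry `B_{x,i}` of the outer distribution matrix: the number of codewords at
distance `i` from `x`. -/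
def outerDist {n : ℕ} (C : Finset (Fin n → ZMod 2)) (x : Fin n → ZMod 2) (i : ℕ) : ℕ :=
  (C.filter (fun c => hammingDist x c = i)).card

/-- `C` is `t`-regular: for `i = 0, …, ρ` and all `x` with `d(x, C) ≤ t`, the number `B_{x,i}`
depends only on `i` and `d(x, C)`. -/
def IsRegularUpTo {n : ℕ} (C : Finset (Fin n → ZMod 2)) (t : ℕ) : Prop :=
  ∀ i ≤ coveringRadius C, ∀ x y : Fin n → ZMod 2,
    distToCode C x ≤ t → distToCode C x = distToCode C y → outerDist C x i = outerDist C y i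

/-- `C` is completely regular: it is `ρ`-regular, where `ρ` is its covering radius. -/
def IsCompletelyRegular {n : ℕ} (C : Finset (Fin n → ZMod 2)) : Prop :=
  IsRegularUpTo C (coveringRadius C)

/-- `C` is uniformly packed in the wide sense: there are rational numbers `β₀, …, β_ρ` with
`∑_{i=0}^ρ β_i B_{x,i} = 1` for every word `x`. -/
def IsUniformlyPackedWide {n : ℕ} (C : Finset (Fin n → ZMod 2)) : Prop :=
  ∃ β : ℕ → ℚ, ∀ x : Fin n → ZMod 2,
    ∑ i ∈ Finset.range (coveringRadius C + 1), β i * (outerDist C x i : ℚ) = 1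

/-- `C` is self-complementary: the complement `c + (1, …, 1)` of every codeword `c` is a
codeword. -/
def IsSelfComplementary {n : ℕ} (C : Finset (Fin n → ZMod 2)) : Prop :=
  ∀ c ∈ C, (fun i => c i + 1) ∈ C

/-- The extended code `C*` of length `n + 1`: append to each codeword `c` the bit
`∑ i, c i + ε`, which is the parity check bit for `ε = 0` and the antiparity check bit for
`ε = 1`. -/
def extendedCode {n : ℕ} (ε : ZMod 2) (C : Finset (Fin n → ZMod 2)) :
    Finset (Fin (n + 1) → ZMod 2) :=
  C.image (fun c => Fin.snoc (α := fun _ => ZMod 2) c (∑ i, c i + ε))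

end BinCode

namespace BinCode

open Finset

/-! Compare the covering radius `ρ` with the number `s` of nonzero dual weights (weights of `u ≠ 0`
at which the Fourier transform of the code is nonzero). Delsarte's bound
`coveringRadius_le_card_dualWeights` gives `ρ ≤ s` for every nonempty code, and
`card_dualWeights_le_coveringRadius` gives `s ≤ ρ` for uniformly packed codes. Appending a bit
raises `ρ` by at most one. But self-complementarity makes all dual weights of `C` even, and for `n`
even each `j` that is zero or a dual weight also yields the odd dual weight `n + 1 - j` of `C*`, so
`s* ≥ 2s + 1`. If `C*` were uniformly packed, then `2ρ + 1 ≤ 2s + 1 ≤ s* ≤ ρ* ≤ ρ + 1`, so `ρ = 0`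
and `C` is the whole space. Complete regularity of `C*` is excluded as well, since it implies
uniform packing (`IsCompletelyRegular.isUniformlyPackedWide`). -/

/-! ### Characters, Fourier transform and dual weights -/

/-- The nontrivial additive character of `ZMod 2`, with rational values. -/
def sgn (a : ZMod 2) : ℚ := if a = 0 then 1 else -1

@[simp] lemma sgn_zero : sgn 0 = 1 := rfl

@[simp] lemma sgn_one : sgn 1 = -1 := rfl

lemma sgn_add (a b : ZMod 2) : sgn (a + b) = sgn a * sgn b := by
  have h : ∀ a : ZMod 2, a = 0 ∨ a = 1 := by decide
  rcases h a with rfl | rfl <;> rcases h b with rfl | rfl <;>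
    simp [show (1 : ZMod 2) + 1 = 0 from rfl]

lemma sgn_ne_zero (a : ZMod 2) : sgn a ≠ 0 := by
  unfold sgn; split_ifs <;> norm_num

lemma sgn_eq_neg_one {a : ZMod 2} (h : a ≠ 0) : sgn a = -1 := if_neg h

lemma sgn_sum {ι : Type*} (s : Finset ι) (f : ι → ZMod 2) :
    sgn (∑ i ∈ s, f i) = ∏ i ∈ s, sgn (f i) := by
  classical
  induction s using Finset.induction_on with
  | empty => simp
  | insert a s ha ih => rw [sum_insert ha, prod_insert ha, sgn_add, ih]

lemma zmod_two_eq_one {a : ZMod 2} (h : a ≠ 0) : a = 1 := by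
  revert a; decide

/-- Orthogonality of characters. -/
lemma sum_sgn_dotProduct_eq_zero {m : ℕ} {z : Fin m → ZMod 2} (hz : z ≠ 0) :
    ∑ u : Fin m → ZMod 2, sgn (u ⬝ᵥ z) = 0 := by
  obtain ⟨i, hi⟩ := Function.ne_iff.mp hz
  have h : ∑ u : Fin m → ZMod 2, sgn (u ⬝ᵥ z) = ∑ u : Fin m → ZMod 2, -sgn (u ⬝ᵥ z) := by
    -- Flipping a coordinate of `u` in the support of `z` reverses the sign.
    refine Fintype.sum_equiv (Equiv.addRight (Pi.single i 1)) _ _ fun u => ?_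
    simp [add_dotProduct, sgn_add, zmod_two_eq_one hi]
  rw [sum_neg_distrib] at h
  linarith

/-- The Fourier transform of the indicator function of `D`. -/
def codeTransform {m : ℕ} (D : Finset (Fin m → ZMod 2)) (u : Fin m → ZMod 2) : ℚ :=
  ∑ c ∈ D, sgn (u ⬝ᵥ c)

@[simp] lemma codeTransform_zero {m : ℕ} (D : Finset (Fin m → ZMod 2)) :
    codeTransform D 0 = D.card := by
  simp [codeTransform]

/-- The nonzero dual weights of `D`. -/
def dualWeights {m : ℕ} (D : Finset (Fin m → ZMod 2)) : Finset ℕ :=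
  (univ.filter fun u => u ≠ 0 ∧ codeTransform D u ≠ 0).image hammingNorm

lemma mem_dualWeights {m : ℕ} {D : Finset (Fin m → ZMod 2)} {k : ℕ} :
    k ∈ dualWeights D ↔ ∃ u, (u ≠ 0 ∧ codeTransform D u ≠ 0) ∧ hammingNorm u = k := by
  simp [dualWeights]

lemma zero_notMem_dualWeights {m : ℕ} (D : Finset (Fin m → ZMod 2)) : 0 ∉ dualWeights D := by
  rw [mem_dualWeights]
  rintro ⟨u, ⟨hu, -⟩, h⟩
  exact hu (hammingNorm_eq_zero.mp h)

/-! ### Distance and covering radius -/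

lemma exists_hammingDist_eq_distToCode {m : ℕ} {D : Finset (Fin m → ZMod 2)} (hD : D.Nonempty)
    (x : Fin m → ZMod 2) : ∃ c ∈ D, hammingDist x c = distToCode D x := by
  obtain ⟨c, hc⟩ := hD
  exact Nat.sInf_mem (s := {k : ℕ | ∃ c ∈ D, hammingDist x c = k}) ⟨_, c, hc, rfl⟩

lemma distToCode_le {m : ℕ} {D : Finset (Fin m → ZMod 2)} {c : Fin m → ZMod 2} (hc : c ∈ D)
    (x : Fin m → ZMod 2) : distToCode D x ≤ hammingDist x c :=
  Nat.sInf_le ⟨c, hc, rfl⟩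

lemma distToCode_le_coveringRadius {m : ℕ} (D : Finset (Fin m → ZMod 2)) (x : Fin m → ZMod 2) :
    distToCode D x ≤ coveringRadius D :=
  le_sup (f := distToCode D) (mem_univ x)

lemma outerDist_eq_zero {m : ℕ} {D : Finset (Fin m → ZMod 2)} {x : Fin m → ZMod 2} {i : ℕ}
    (h : i < distToCode D x) : outerDist D x i = 0 := by
  rw [outerDist, card_eq_zero, filter_eq_empty_iff]
  intro c hc hi
  have := distToCode_le hc x
  omega

lemma outerDist_distToCode_ne_zero {m : ℕ} {D : Finset (Fin m → ZMod 2)} (hD : D.Nonempty)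
    (x : Fin m → ZMod 2) : outerDist D x (distToCode D x) ≠ 0 := by
  obtain ⟨c, hc, h⟩ := exists_hammingDist_eq_distToCode hD x
  exact (card_pos.mpr ⟨c, mem_filter.mpr ⟨hc, h⟩⟩).ne'

lemma eq_univ_of_coveringRadius_eq_zero {m : ℕ} {D : Finset (Fin m → ZMod 2)} (hD : D.Nonempty)
    (h : coveringRadius D = 0) : D = univ := by
  refine eq_univ_of_forall fun x => ?_
  obtain ⟨c, hc, hx⟩ := exists_hammingDist_eq_distToCode hD x
  have := distToCode_le_coveringRadius D x
  rw [show distToCode D x = 0 by omega, hammingDist_eq_zero] at hx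
  exact hx ▸ hc

/-! ### Delsarte's bound on the covering radius -/

lemma natCast_hammingNorm_eq_sum {m : ℕ} (u : Fin m → ZMod 2) :
    (hammingNorm u : ℚ) = ∑ i, (1 - sgn (u i)) / 2 := by
  rw [hammingNorm, card_filter, Nat.cast_sum]
  refine sum_congr rfl fun i _ => ?_
  by_cases h : u i = 0
  · simp [h]
  · simp [zmod_two_eq_one h]

lemma hammingNorm_le_add_single {m : ℕ} (z : Fin m → ZMod 2) (i : Fin m) :
    hammingNorm z ≤ hammingNorm (z + Pi.single i 1) + 1 := by
  have h : hammingNorm (Pi.single i 1 : Fin m → ZMod 2) ≤ 1 := by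
    rw [hammingNorm, card_le_one]
    intro a ha b hb
    simp only [mem_filter, mem_univ, true_and, Pi.single_apply, ne_eq, ite_eq_right_iff,
      Classical.not_imp] at ha hb
    rw [ha.1, hb.1]
  have := hammingDist_triangle z (z + Pi.single i 1) 0
  have h2 := hammingDist_eq_hammingNorm z (z + Pi.single i 1)
  have h3 : hammingNorm (-(Pi.single i 1 : Fin m → ZMod 2)) =
      hammingNorm (Pi.single i 1 : Fin m → ZMod 2) := by
    rw [show -(Pi.single i 1 : Fin m → ZMod 2) = Pi.single i 1 by ext; simp [ZMod.neg_eq_self_mod_two]]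
  simp only [hammingDist_zero_right] at this
  rw [show -z + (z + Pi.single i 1) = Pi.single i 1 by abel] at h2
  omega

/-- A polynomial of degree `#S` in the weight has no Fourier coefficient of weight more
than `#S`. -/
lemma sum_prod_sub_hammingNorm_mul_sgn_eq_zero {m : ℕ} (S : Finset ℕ) (z : Fin m → ZMod 2)
    (hz : S.card < hammingNorm z) :
    ∑ u : Fin m → ZMod 2, (∏ k ∈ S, ((k : ℚ) - hammingNorm u)) * sgn (u ⬝ᵥ z) = 0 := by
  induction S using Finset.induction_on generalizing z with
  | empty =>
    simp only [prod_empty, one_mul]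
    exact sum_sgn_dotProduct_eq_zero (by rintro rfl; simp at hz)
  | insert a S ha ih =>
    rw [card_insert_of_notMem ha] at hz
    set P : (Fin m → ZMod 2) → ℚ := fun u => ∏ k ∈ S, ((k : ℚ) - hammingNorm u)
    -- The weight of `u` is `∑ i, (1 - sgn (u i)) / 2`, and multiplying a character by `sgn (u i)`
    -- shifts `z` by a unit vector. So each factor costs at most one unit of the weight of `z`.
    have key : ∀ u : Fin m → ZMod 2,
        (∏ k ∈ insert a S, ((k : ℚ) - hammingNorm u)) * sgn (u ⬝ᵥ z) =
          a * (P u * sgn (u ⬝ᵥ z)) - ∑ i, (P u * sgn (u ⬝ᵥ z) -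
            P u * sgn (u ⬝ᵥ (z + Pi.single i 1))) / 2 := by
      intro u
      have : ∑ i, (P u * sgn (u ⬝ᵥ z) - P u * sgn (u ⬝ᵥ (z + Pi.single i 1))) / 2 =
          (∑ i, (1 - sgn (u i)) / 2) * (P u * sgn (u ⬝ᵥ z)) := by
        rw [sum_mul]
        refine sum_congr rfl fun i _ => ?_
        simp only [dotProduct_add, dotProduct_single, mul_one, sgn_add]
        ring
      rw [this, ← natCast_hammingNorm_eq_sum, prod_insert ha]
      ring
    rw [sum_congr rfl fun u _ => key u, sum_sub_distrib, ← mul_sum, ih z (by omega), sum_comm]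
    simp only [mul_zero, zero_sub, neg_eq_zero]
    refine sum_eq_zero fun i _ => ?_
    have := hammingNorm_le_add_single z i
    rw [← sum_div, sum_sub_distrib, ih z (by omega), ih _ (by omega)]
    simp

/-- The polynomial in the weight that vanishes exactly at the dual weights isolates the term `u =
0`, which is nonzero. If some `x` were farther than `s` from `D`, the same sum, expanded over
codewords, would vanish term by term. -/
theorem coveringRadius_le_card_dualWeights {m : ℕ} {D : Finset (Fin m → ZMod 2)}
    (hD : D.Nonempty) : coveringRadius D ≤ (dualWeights D).card := by
  refine Finset.sup_le fun x _ => ?_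
  by_contra! hlt
  set S := dualWeights D
  have h1 : ∑ u : Fin m → ZMod 2,
      (∏ k ∈ S, ((k : ℚ) - hammingNorm u)) * (codeTransform D u * sgn (u ⬝ᵥ x)) =
        (∏ k ∈ S, (k : ℚ)) * D.card := by
    rw [sum_eq_single 0]
    · simp
    · intro u _ hu
      by_cases h : codeTransform D u = 0
      · simp [h]
      · rw [prod_eq_zero (mem_dualWeights.mpr ⟨u, ⟨hu, h⟩, rfl⟩) (sub_self _), zero_mul]
    · simp
  have h2 : ∑ u : Fin m → ZMod 2,
      (∏ k ∈ S, ((k : ℚ) - hammingNorm u)) * (codeTransform D u * sgn (u ⬝ᵥ x)) = 0 := by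
    simp only [codeTransform, sum_mul, mul_sum]
    rw [sum_comm]
    refine sum_eq_zero fun c hc => ?_
    simp only [← sgn_add, ← dotProduct_add]
    refine sum_prod_sub_hammingNorm_mul_sgn_eq_zero S (c + x) ?_
    have h := distToCode_le hc x
    rw [hammingDist_comm, hammingDist_eq_hammingNorm,
      show -c + x = c + x by ext; simp [ZMod.neg_eq_self_mod_two]] at h
    omega
  rw [h1] at h2
  rcases mul_eq_zero.mp h2 with h | h
  · obtain ⟨k, hk, h0⟩ := prod_eq_zero_iff.mp h
    exact zero_notMem_dualWeights D (Nat.cast_eq_zero.mp h0 ▸ hk)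
  · exact hD.card_pos.ne' (Nat.cast_eq_zero.mp h)

/-! ### Krawtchouk polynomials and uniformly packed codes -/

lemma sum_sgn_pow {m : ℕ} (u : Fin m → ZMod 2) (k : ℕ) :
    ∑ i, sgn (u i) ^ k = if Even k then (m : ℚ) else m - 2 * hammingNorm u := by
  have hs : ∀ i, sgn (u i) ^ 2 = 1 := fun i => by
    unfold sgn; split_ifs <;> norm_num
  split_ifs with h
  · obtain ⟨j, rfl⟩ := h
    simp [← two_mul, pow_mul, hs]
  · obtain ⟨j, rfl⟩ := Nat.not_even_iff_odd.mp h
    rw [natCast_hammingNorm_eq_sum]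
    simp only [pow_succ, pow_mul, hs, one_pow, one_mul, mul_sum]
    rw [eq_sub_iff_add_eq, ← sum_add_distrib]
    simp [mul_div_cancel₀]

/-- Elementary symmetric functions of the signs of `u` are polynomials in the weight of `u`. -/
lemma exists_polynomial_eval_esymm (m i : ℕ) :
    ∃ K : Polynomial ℚ, K.natDegree ≤ i ∧ ∀ u : Fin m → ZMod 2,
      (MvPolynomial.esymm (Fin m) ℚ i).eval (fun j => sgn (u j)) = K.eval (hammingNorm u : ℚ) := by
  induction i using Nat.strong_induction_on with
  | _ i ih =>
    rcases Nat.eq_zero_or_pos i with rfl | hi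
    · exact ⟨1, by simp, by simp⟩
    choose! K hdeg hK using ih
    let p : ℕ → Polynomial ℚ := fun k =>
      if Even k then Polynomial.C (m : ℚ) else Polynomial.C (m : ℚ) - Polynomial.C 2 * Polynomial.X
    have hp : ∀ k, 1 ≤ k → (p k).natDegree ≤ k := by
      intro k hk
      refine le_trans ?_ hk
      simp only [p]
      split_ifs
      · simp
      · compute_degree
    have hpe : ∀ k (u : Fin m → ZMod 2),
        (MvPolynomial.psum (Fin m) ℚ k).eval (fun j => sgn (u j)) =
          (p k).eval (hammingNorm u : ℚ) := by
      intro k u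
      simp only [MvPolynomial.psum, map_sum, map_pow, MvPolynomial.eval_X, sum_sgn_pow, p]
      split_ifs <;> simp
    -- Newton's identity solved for the `i`-th elementary symmetric function; the power sums of
    -- signs are constant or linear in the weight.
    refine ⟨Polynomial.C ((i : ℚ)⁻¹ * (-1) ^ (i + 1)) *
      ∑ a ∈ antidiagonal i with a.1 < i, Polynomial.C ((-1 : ℚ) ^ a.1) * K a.1 * p a.2, ?_, ?_⟩
    · refine (Polynomial.natDegree_C_mul_le _ _).trans (Polynomial.natDegree_sum_le_of_forall_le _ _ ?_)
      intro a ha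
      simp only [mem_filter, HasAntidiagonal.mem_antidiagonal] at ha
      have h1 := hdeg a.1 ha.2
      have h2 := hp a.2 (by omega)
      refine Polynomial.natDegree_mul_le.trans ?_
      have h3 := Polynomial.natDegree_C_mul_le ((-1 : ℚ) ^ a.1) (K a.1)
      omega
    · intro u
      have h := congrArg (MvPolynomial.eval fun j => sgn (u j))
        (MvPolynomial.mul_esymm_eq_sum (Fin m) ℚ i)
      have hi' : (i : ℚ) ≠ 0 := by positivity
      simp only [map_mul, map_natCast, map_pow, map_neg, map_one, map_sum] at h
      rw [Polynomial.eval_mul, Polynomial.eval_C, Polynomial.eval_finsetSum, mul_assoc,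
        eq_inv_mul_iff_mul_eq₀ hi', h]
      congr 1
      refine sum_congr rfl fun a ha => ?_
      rw [hpe, hK a.1 (mem_filter.mp ha).2]
      simp

/-- The character sum over a sphere is an elementary symmetric function. -/
lemma sum_sphere_sgn_eq_esymm {m : ℕ} (u : Fin m → ZMod 2) (i : ℕ) :
    ∑ z : Fin m → ZMod 2 with hammingNorm z = i, sgn (u ⬝ᵥ z) =
      (MvPolynomial.esymm (Fin m) ℚ i).eval (fun j => sgn (u j)) := by
  simp only [MvPolynomial.esymm, map_sum, map_prod, MvPolynomial.eval_X]
  refine sum_bij' (fun z _ => univ.filter fun j => z j ≠ 0)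
    (fun T _ => fun j => if j ∈ T then 1 else 0) ?_ ?_ ?_ ?_ ?_
  · intro z hz
    simpa [mem_powersetCard, hammingNorm] using hz
  · intro T hT
    simpa [hammingNorm, mem_powersetCard] using hT
  · intro z _
    ext j
    by_cases h : z j = 0
    · simp [h]
    · simp [zmod_two_eq_one h]
  · intro T _
    ext j
    simp
  · intro z _
    rw [dotProduct, sgn_sum, prod_filter]
    refine prod_congr rfl fun j _ => ?_
    by_cases h : z j = 0
    · simp [h]
    · simp [zmod_two_eq_one h]

/-- `outerDist D · i` is the convolution of `D` with a sphere, so its transform is a product. -/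
lemma sum_sgn_mul_outerDist {m : ℕ} (D : Finset (Fin m → ZMod 2)) (u : Fin m → ZMod 2) (i : ℕ) :
    ∑ x : Fin m → ZMod 2, sgn (u ⬝ᵥ x) * (outerDist D x i : ℚ) =
      codeTransform D u * ∑ z : Fin m → ZMod 2 with hammingNorm z = i, sgn (u ⬝ᵥ z) := by
  simp only [outerDist, card_filter, Nat.cast_sum, mul_sum, codeTransform, sum_mul]
  rw [sum_comm, sum_comm (t := D)]
  refine sum_congr rfl fun c _ => ?_
  rw [sum_filter]
  refine Fintype.sum_equiv (Equiv.subRight c) _ _ fun x => ?_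
  have h : sgn (u ⬝ᵥ x) = sgn (u ⬝ᵥ c) * sgn (u ⬝ᵥ (x - c)) := by
    rw [← sgn_add, ← dotProduct_add, add_sub_cancel]
  have h2 : hammingDist x c = hammingNorm (x - c) := by
    rw [hammingDist_comm, hammingDist_eq_hammingNorm, neg_add_eq_sub]
  simp [h2, h]

/-- Transforming the packing identity gives a polynomial `P` of degree at most `ρ` with
`codeTransform D u * P(wt u) = 0` for `u ≠ 0`. Every dual weight is then a root of `P`. -/
theorem card_dualWeights_le_coveringRadius {m : ℕ} {D : Finset (Fin m → ZMod 2)}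
    (hD : IsUniformlyPackedWide D) : (dualWeights D).card ≤ coveringRadius D := by
  obtain ⟨β, hβ⟩ := hD
  choose K hdeg hK using exists_polynomial_eval_esymm m
  set P : Polynomial ℚ := ∑ i ∈ range (coveringRadius D + 1), Polynomial.C (β i) * K i
  have hP : ∀ u, codeTransform D u * P.eval (hammingNorm u : ℚ) =
      ∑ x : Fin m → ZMod 2, sgn (u ⬝ᵥ x) := by
    intro u
    calc codeTransform D u * P.eval (hammingNorm u : ℚ)
        = ∑ i ∈ range (coveringRadius D + 1),
            β i * ∑ x : Fin m → ZMod 2, sgn (u ⬝ᵥ x) * (outerDist D x i : ℚ) := by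
          rw [Polynomial.eval_finsetSum, mul_sum]
          refine sum_congr rfl fun i _ => ?_
          rw [sum_sgn_mul_outerDist, sum_sphere_sgn_eq_esymm, hK, Polynomial.eval_mul,
            Polynomial.eval_C]
          ring
      _ = ∑ x : Fin m → ZMod 2, sgn (u ⬝ᵥ x) *
            ∑ i ∈ range (coveringRadius D + 1), β i * (outerDist D x i : ℚ) := by
          simp only [mul_sum]
          rw [sum_comm]
          exact sum_congr rfl fun x _ => sum_congr rfl fun i _ => by ring
      _ = ∑ x : Fin m → ZMod 2, sgn (u ⬝ᵥ x) := by simp only [hβ, mul_one]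
  -- At `u = 0` the transform of the constant `1` is the size of the space.
  have hP0 : P ≠ 0 := by
    intro h
    have := hP 0
    simp only [h, Polynomial.eval_zero, mul_zero, zero_dotProduct, sgn_zero, sum_const, card_univ,
      nsmul_eq_mul, mul_one] at this
    exact Fintype.card_ne_zero (Nat.cast_eq_zero.mp this.symm)
  have hPdeg : P.natDegree ≤ coveringRadius D := by
    refine Polynomial.natDegree_sum_le_of_forall_le _ _ fun i hi => ?_
    have h1 := Polynomial.natDegree_C_mul_le (β i) (K i)
    have h2 := hdeg i
    have h3 := mem_range.mp hi
    omega
  refine le_trans ?_ hPdeg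
  rw [← card_image_of_injective (dualWeights D) (Nat.cast_injective (R := ℚ))]
  refine Polynomial.card_le_degree_of_subset_roots fun q hq => ?_
  rw [mem_val, mem_image] at hq
  obtain ⟨k, hk, rfl⟩ := hq
  obtain ⟨u, ⟨hu, hDu⟩, rfl⟩ := mem_dualWeights.mp hk
  rw [Polynomial.mem_roots hP0]
  have h := hP u
  simp only [dotProduct_comm u] at h
  rw [sum_sgn_dotProduct_eq_zero hu] at h
  exact (mul_eq_zero.mp h).resolve_left hDu

/-! ### Completely regular codes are uniformly packed -/

/-- The system for `β` is triangular: `B_{x,i} = 0` for `i < d(x, D)`, while the diagonal entries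
are nonzero. It is solved from the farthest words inwards. -/
theorem IsCompletelyRegular.isUniformlyPackedWide {m : ℕ} {D : Finset (Fin m → ZMod 2)}
    (hD : D.Nonempty) (h : IsCompletelyRegular D) : IsUniformlyPackedWide D := by
  suffices key : ∀ k, ∃ β : ℕ → ℚ, ∀ x, coveringRadius D < distToCode D x + k →
      ∑ i ∈ range (coveringRadius D + 1), β i * (outerDist D x i : ℚ) = 1 by
    obtain ⟨β, hβ⟩ := key (coveringRadius D + 1)
    exact ⟨β, fun x => hβ x (by omega)⟩
  intro k
  induction k with
  | zero =>
    refine ⟨0, fun x hx => ?_⟩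
    have := distToCode_le_coveringRadius D x
    omega
  | succ k ih =>
    obtain ⟨β, hβ⟩ := ih
    by_cases hx : ∃ x, distToCode D x + k = coveringRadius D
    · obtain ⟨x₀, hx₀⟩ := hx
      set l := distToCode D x₀
      have hl : l ∈ range (coveringRadius D + 1) := mem_range.mpr (by omega)
      have hB : (outerDist D x₀ l : ℚ) ≠ 0 :=
        Nat.cast_ne_zero.mpr (outerDist_distToCode_ne_zero hD x₀)
      refine ⟨Function.update β l ((1 - ∑ i ∈ (range (coveringRadius D + 1)).erase l,
        β i * (outerDist D x₀ i : ℚ)) / outerDist D x₀ l), fun x hx => ?_⟩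
      rw [← add_sum_erase _ _ hl, Function.update_self]
      have he : ∀ y, ∑ i ∈ (range (coveringRadius D + 1)).erase l, Function.update β l
          ((1 - ∑ i ∈ (range (coveringRadius D + 1)).erase l,
            β i * (outerDist D x₀ i : ℚ)) / outerDist D x₀ l) i * (outerDist D y i : ℚ) =
          ∑ i ∈ (range (coveringRadius D + 1)).erase l, β i * (outerDist D y i : ℚ) := fun y =>
        sum_congr rfl fun i hi => by rw [Function.update_of_ne (ne_of_mem_erase hi)]
      rw [he]
      -- Words beyond distance `l` do not see `β l`; those at distance `l` have the same row as
      -- `x₀`.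
      rcases (show l ≤ distToCode D x by omega).lt_or_eq with hlt | heq
      · have h1 := hβ x (by omega)
        rw [← add_sum_erase _ _ hl] at h1
        rw [outerDist_eq_zero hlt] at h1 ⊢
        simpa using h1
      · have hr : ∀ i ∈ range (coveringRadius D + 1), outerDist D x i = outerDist D x₀ i :=
          fun i hi => h i (Nat.lt_succ_iff.mp (mem_range.mp hi)) x x₀
            (distToCode_le_coveringRadius D x) heq.symm
        have hs : ∑ i ∈ (range (coveringRadius D + 1)).erase l, β i * (outerDist D x i : ℚ) =
            ∑ i ∈ (range (coveringRadius D + 1)).erase l, β i * (outerDist D x₀ i : ℚ) :=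
          sum_congr rfl fun i hi => by rw [hr i (mem_of_mem_erase hi)]
        rw [hr l hl, hs, div_mul_cancel₀ _ hB, sub_add_cancel]
    · refine ⟨β, fun x hlt => hβ x ?_⟩
      have : distToCode D x + k ≠ coveringRadius D := fun h => hx ⟨x, h⟩
      omega

/-! ### Extended codes -/

lemma hammingDist_snoc_le {n : ℕ} (x c : Fin n → ZMod 2) (a b : ZMod 2) :
    hammingDist (Fin.snoc (α := fun _ => ZMod 2) x a) (Fin.snoc (α := fun _ => ZMod 2) c b) ≤
      hammingDist x c + 1 := by
  simp only [hammingDist, card_filter, Fin.sum_univ_castSucc, Fin.snoc_castSucc, Fin.snoc_last]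
  split_ifs <;> simp

lemma hammingNorm_snoc {n : ℕ} (x : Fin n → ZMod 2) (a : ZMod 2) :
    hammingNorm (Fin.snoc (α := fun _ => ZMod 2) x a) = hammingNorm x + if a = 0 then 0 else 1 := by
  simp only [hammingNorm, card_filter, Fin.sum_univ_castSucc, Fin.snoc_castSucc, Fin.snoc_last]
  split_ifs <;> simp_all

lemma snoc_dotProduct_snoc {n : ℕ} (x y : Fin n → ZMod 2) (a b : ZMod 2) :
    Fin.snoc (α := fun _ => ZMod 2) x a ⬝ᵥ Fin.snoc (α := fun _ => ZMod 2) y b =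
      x ⬝ᵥ y + a * b := by
  simp [dotProduct, Fin.sum_univ_castSucc]

lemma coveringRadius_extendedCode_le {n : ℕ} {C : Finset (Fin n → ZMod 2)} (hC : C.Nonempty)
    (ε : ZMod 2) : coveringRadius (extendedCode ε C) ≤ coveringRadius C + 1 := by
  refine Finset.sup_le fun y _ => ?_
  obtain ⟨c, hc, h⟩ := exists_hammingDist_eq_distToCode hC (Fin.init y)
  have h1 := distToCode_le (D := extendedCode ε C) (mem_image_of_mem _ hc) y
  have h2 := hammingDist_snoc_le (Fin.init y) c (y (Fin.last n)) (∑ i, c i + ε)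
  have h3 := Fin.snoc_init_self (α := fun _ => ZMod 2) y
  rw [h3] at h2
  have h4 := distToCode_le_coveringRadius C (Fin.init y)
  omega

/-- Pairing with the check bit contributes `a * ∑ i, c i + a * ε`: a shift of `u` by the constant
word `a`, and a global sign. -/
lemma codeTransform_extendedCode {n : ℕ} (C : Finset (Fin n → ZMod 2)) (ε : ZMod 2)
    (u : Fin n → ZMod 2) (a : ZMod 2) :
    codeTransform (extendedCode ε C) (Fin.snoc (α := fun _ => ZMod 2) u a) =
      sgn (a * ε) * codeTransform C (u + fun _ => a) := by
  rw [codeTransform, extendedCode, sum_image, codeTransform, mul_sum]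
  · refine sum_congr rfl fun c _ => ?_
    rw [snoc_dotProduct_snoc, ← sgn_add, add_dotProduct,
      show (fun _ => a) ⬝ᵥ c = a * ∑ i, c i by simp [dotProduct, mul_sum]]
    congr 1
    ring
  · intro c _ d _ h
    simpa using congrArg (Fin.init (α := fun _ => ZMod 2)) h

lemma sum_eq_natCast_hammingNorm {n : ℕ} (u : Fin n → ZMod 2) :
    ∑ i, u i = (hammingNorm u : ZMod 2) := by
  rw [hammingNorm, card_filter, Nat.cast_sum]
  refine sum_congr rfl fun i _ => ?_
  by_cases h : u i = 0
  · simp [h]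
  · simp [zmod_two_eq_one h]

/-- Complementing codewords multiplies the transform at `u` by `(-1) ^ wt u`. -/
lemma IsSelfComplementary.even_hammingNorm {n : ℕ} {C : Finset (Fin n → ZMod 2)}
    (hC : IsSelfComplementary C) {u : Fin n → ZMod 2} (hu : codeTransform C u ≠ 0) :
    Even (hammingNorm u) := by
  by_contra hodd
  have h1 : sgn (∑ i, u i) = -1 := by
    refine sgn_eq_neg_one ?_
    rwa [sum_eq_natCast_hammingNorm, Ne, ZMod.natCast_eq_zero_iff_even]
  have h2 : codeTransform C u = -codeTransform C u := by
    have hinv : ∀ c : Fin n → ZMod 2, (fun i => c i + 1 + 1) = c := fun c => by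
      ext i
      rw [add_assoc, show (1 : ZMod 2) + 1 = 0 from rfl, add_zero]
    rw [codeTransform, ← sum_neg_distrib]
    refine sum_bij' (fun c _ => fun i => c i + 1) (fun c _ => fun i => c i + 1)
      (fun c hc => hC c hc) (fun c hc => hC c hc) (fun c _ => hinv c) (fun c _ => hinv c) ?_
    intro c _
    rw [show (fun i => c i + 1) = c + 1 from rfl, dotProduct_add, sgn_add, dotProduct_one, h1]
    ring
  exact hu (by linarith)

lemma hammingNorm_add_one {n : ℕ} (u : Fin n → ZMod 2) :
    hammingNorm (u + fun _ => 1) + hammingNorm u = n := by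
  simp only [hammingNorm, card_filter, ← sum_add_distrib]
  rw [sum_congr rfl (g := fun _ => 1)]
  · simp
  · intro i _
    by_cases h : u i = 0
    · simp [h]
    · simp [zmod_two_eq_one h, show (1 : ZMod 2) + 1 = 0 from rfl]

/-- Extending a self-complementary code of even length doubles the number of dual weights
and adds one more. -/
theorem card_dualWeights_extendedCode {n : ℕ} (hn : Even n) {C : Finset (Fin n → ZMod 2)}
    (hne : C.Nonempty) (hsc : IsSelfComplementary C) (ε : ZMod 2) :
    2 * (dualWeights C).card + 1 ≤ (dualWeights (extendedCode ε C)).card := by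
  have heven : ∀ k ∈ insert 0 (dualWeights C), Even k ∧ k ≤ n := by
    intro k hk
    rcases mem_insert.mp hk with rfl | hk
    · simp
    · obtain ⟨u, ⟨-, hu⟩, rfl⟩ := mem_dualWeights.mp hk
      exact ⟨hsc.even_hammingNorm hu, by simpa using hammingNorm_le_card_fintype (x := u)⟩
  -- Last coordinate `0` keeps the weight; last coordinate `1` goes with the complement of `u`.
  -- Inserting `0` accounts for the extra dual weight `n + 1`.
  have hsub : dualWeights C ∪ (insert 0 (dualWeights C)).image (fun k => n + 1 - k) ⊆
      dualWeights (extendedCode ε C) := by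
    refine union_subset (fun k hk => ?_) (fun k hk => ?_)
    · obtain ⟨u, ⟨h0, hu⟩, rfl⟩ := mem_dualWeights.mp hk
      have hw := hammingNorm_snoc u 0
      simp only [if_true, add_zero] at hw
      refine mem_dualWeights.mpr ⟨Fin.snoc (α := fun _ => ZMod 2) u 0, ⟨?_, ?_⟩, hw⟩
      · rw [← hammingNorm_ne_zero_iff, hw]
        exact hammingNorm_ne_zero_iff.mpr h0
      · rw [codeTransform_extendedCode]
        simpa [show (u + fun _ => 0) = u from add_zero u] using hu
    · obtain ⟨j, hj, rfl⟩ := mem_image.mp hk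
      obtain ⟨u, hu, rfl⟩ : ∃ u, codeTransform C u ≠ 0 ∧ hammingNorm u = j := by
        rcases mem_insert.mp hj with rfl | hj
        · exact ⟨0, by simpa using hne.ne_empty, hammingNorm_zero⟩
        · obtain ⟨u, ⟨-, hu⟩, h⟩ := mem_dualWeights.mp hj
          exact ⟨u, hu, h⟩
      have hw := hammingNorm_snoc (u + fun _ => 1) 1
      have hadd := hammingNorm_add_one u
      rw [if_neg one_ne_zero] at hw
      refine mem_dualWeights.mpr ⟨Fin.snoc (α := fun _ => ZMod 2) (u + fun _ => 1) 1,
        ⟨?_, ?_⟩, by omega⟩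
      · rw [← hammingNorm_ne_zero_iff, hw]
        omega
      · rw [codeTransform_extendedCode]
        refine mul_ne_zero (sgn_ne_zero _) ?_
        rwa [show ((u + fun _ => 1) + fun _ => (1 : ZMod 2)) = u by
          ext i
          simp [add_assoc, show (1 : ZMod 2) + 1 = 0 from rfl]]
  refine le_trans (le_of_eq ?_) (card_le_card hsub)
  rw [card_union_of_disjoint, card_image_of_injOn,
    card_insert_of_notMem (zero_notMem_dualWeights C)]
  · omega
  · intro a ha b hb hab
    have h1 := heven a ha
    have h2 := heven b hb
    simp only at hab
    omega
  -- Dual weights of `C` are even, whereas `n + 1 - j` is odd for `n` and `j` even with `j ≤ n`.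
  · rw [disjoint_left]
    intro k hk hk'
    obtain ⟨j, hj, rfl⟩ := mem_image.mp hk'
    have h1 := (heven _ (mem_insert_of_mem hk)).1
    have h2 := heven j hj
    rw [Nat.even_iff] at h1 h2 hn
    omega

end BinCode

theorem mainTheorem1 {n : ℕ} (hn : Even n) (C : Finset (Fin n → ZMod 2))
    (hne : C.Nonempty) (hC : C ≠ Finset.univ)
    (hCR : BinCode.IsCompletelyRegular C) (hsc : BinCode.IsSelfComplementary C) (ε : ZMod 2) :
    ¬ BinCode.IsUniformlyPackedWide (BinCode.extendedCode ε C) ∧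
      ¬ BinCode.IsCompletelyRegular (BinCode.extendedCode ε C) := by
  have hU : ¬ BinCode.IsUniformlyPackedWide (BinCode.extendedCode ε C) := by
    intro h
    have h1 := BinCode.card_dualWeights_le_coveringRadius h
    have h2 := BinCode.card_dualWeights_extendedCode hn hne hsc ε
    have h3 := BinCode.coveringRadius_extendedCode_le hne ε
    have h4 := BinCode.coveringRadius_le_card_dualWeights hne
    exact hC (BinCode.eq_univ_of_coveringRadius_eq_zero hne (by omega))
  exact ⟨hU, fun h => hU (h.isUniformlyPackedWide (hne.image _))⟩
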